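/- For $n\ge 1$ let $\mathrm{QAP}_n=\operatorname{conv}\{yy^{T} : y=\operatorname{vec}(P_\sigma),\ \sigma\in S_n\}\subset\mathbb{R}^{n^2\times n^2}$, where $P_\sigma$ is the $n\times n$ permutation matrix of $\sigma$; the entries of $Y\in\mathbb{R}^{n^2\times n^2}$ are written $Y_{ij,kl}$ with $i,j,k,l\in[n]$. A relaxation of $\mathrm{QAP}_n$ is the solution set $R\subset\mathbb{R}^{n^2\times n^2}$ of a system of linear inequalities such that $\mathrm{QAP}_n\subseteq R$. The QAP5 inequalities are $$\sum_{i,j,k,l\in[n]} n_{ij}n_{kl}\,Y_{ij,kl}-(2\beta-1)\sum_{i,j\in[n]} n_{ij}\,Y_{ij,ij}\ \ge\ \tfrac14-\left(\beta-\tfrac12\right)^2,$$ one for each choice of integers $\beta$ and $n_{ij}$ ($i,j\in[n]$). The extension complexity $\mathrm{xc}(R)$ of $R\subset\mathbb{R}^d$ is the minimum number of facets of a polytope $Q\subset\mathbb{R}^{d+r}$, over all $r\ge 0$, with $R=\{x\in\mathbb{R}^d : \exists y\in\mathbb{R}^r,\ (x,y)\in Q\}$ (and $\mathrm{xc}(R)=\infty$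 if there is no such $Q$, i.e. if $R$ is not a polytope). Theorem. Let $R_n$ be any bounded relaxation of $\mathrm{QAP}_n$ for which all the QAP5 inequalities are valid. Then $\mathrm{xc}(R_n)\ge 2^{\Omega(n)}$. That is, there are absolute constants $c>0$ and $N\in\mathbb{N}$ such that for every $n\ge N$ and every bounded relaxation $R$ of $\mathrm{QAP}_n$ all of whose points satisfy every QAP5 inequality, $\mathrm{xc}(R)\ge 2^{cn}$. -/

import Mathlib

open scoped ENNReal

noncomputable section

/-- The solution set of a system of linear inequalities `f x ≤ b`, `(f, b) ∈ H`. -/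
def solutionSet {E : Type*} [NormedAddCommGroup E] [NormedSpace ℝ E]
    (H : Set ((E →L[ℝ] ℝ) × ℝ)) : Set E :=
  {x | ∀ h ∈ H, h.1 x ≤ h.2}

/-- A polytope: a bounded solution set of finitely many linear inequalities. -/
def IsPolytope {E : Type*} [NormedAddCommGroup E] [NormedSpace ℝ E] (P : Set E) : Prop :=
  Bornology.IsBounded P ∧ ∃ H : Set ((E →L[ℝ] ℝ) × ℝ), H.Finite ∧ P = solutionSet H

/-- The dimension of the affine hull of a (non-empty) set. -/
def affineDim {E : Type*} [NormedAddCommGroup E] [NormedSpace ℝ E] (P : Set E) : ℕ :=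
  Module.finrank ℝ (affineSpan ℝ P).direction

/-- A facet of `P`: a non-empty face, i.e. the set of maximizers over `P` of some linear
functional, whose dimension is one less than that of `P`. -/
def IsFacet {E : Type*} [NormedAddCommGroup E] [NormedSpace ℝ E] (P F : Set E) : Prop :=
  IsExposed ℝ P F ∧ F.Nonempty ∧ affineDim F + 1 = affineDim P

/-- The size of a polytope: its number of facets. -/
def polytopeSize {E : Type*} [NormedAddCommGroup E] [NormedSpace ℝ E] (P : Set E) : ℕ∞ :=
  {F : Set E | IsFacet P F}.encard

/-- The polytope `Q`, in a space with `r` additional coordinates, is an extended formulation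
of `P`: it projects onto `P`. -/
def IsExtension {E : Type*} [NormedAddCommGroup E] [NormedSpace ℝ E] (P : Set E) {r : ℕ}
    (Q : Set (E × (Fin r → ℝ))) : Prop :=
  IsPolytope Q ∧ P = {x | ∃ y : Fin r → ℝ, (x, y) ∈ Q}

/-- The extension complexity of `P`: the least size of an extended formulation of `P`
(`⊤` if `P` has none, that is, if `P` is not a polytope). -/
def extensionComplexity {E : Type*} [NormedAddCommGroup E] [NormedSpace ℝ E]
    (P : Set E) : ℕ∞ :=
  ⨅ (r : ℕ) (Q : Set (E × (Fin r → ℝ))) (_ : IsExtension P Q), polytopeSize Q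

/-- The space of real `n² × n²` matrices `Y`, with rows and columns indexed by pairs;
`Y (i, j) (k, l)` is the entry `Y_{ij,kl}`. -/
abbrev QAPSpace (n : ℕ) : Type := Fin n × Fin n → Fin n × Fin n → ℝ

/-- The matrix `y yᵀ`, where `y` is the vectorized permutation matrix of `σ`. -/
def qapVertex {n : ℕ} (σ : Equiv.Perm (Fin n)) : QAPSpace n :=
  fun p q => σ.permMatrix ℝ p.1 p.2 * σ.permMatrix ℝ q.1 q.2

/-- The QAP polytope. -/
def qapPolytope (n : ℕ) : Set (QAPSpace n) :=
  convexHull ℝ (Set.range (qapVertex (n := n)))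

/-- `R` is a relaxation of `P`: the solution set of a system of linear inequalities, and
it contains `P`. -/
def IsRelaxation {E : Type*} [NormedAddCommGroup E] [NormedSpace ℝ E] (P R : Set E) : Prop :=
  (∃ H : Set ((E →L[ℝ] ℝ) × ℝ), R = solutionSet H) ∧ P ⊆ R

/-- The matrix `Y` satisfies the QAP5 inequality with integer parameters `β` and `ν i j`. -/
def SatisfiesQAP5 {n : ℕ} (β : ℤ) (ν : Fin n → Fin n → ℤ) (Y : QAPSpace n) : Prop :=
  (∑ i, ∑ j, ∑ k, ∑ l, (ν i j : ℝ) * (ν k l : ℝ) * Y (i, j) (k, l))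
      - (2 * (β : ℝ) - 1) * (∑ i, ∑ j, (ν i j : ℝ) * Y (i, j) (i, j))
    ≥ 1 / 4 - ((β : ℝ) - 1 / 2) ^ 2

end

/-!
A point of a polyhedron lies outside a given face if and only if some facet contains the face and
misses the point. Hence every facet `F` of an extension of `R` yields a combinatorial rectangle
(faces contained in `F`) × (points outside `F`), and these rectangles cover exactly the nonzero
entries of the slack matrix of `R`, for any choice of valid inequalities and points of `R`.

The QAP5 inequality with `β = 2` whose coefficients are the indicator of `{(i, i) | i ∈ a}` has
slack `(1 - t) * (2 - t)` at the vertex of `σ`, where `t` is the number of fixed points of `σ` in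
`a`. Since nearly every set `b` is the fixed point set of a permutation, the slack matrix contains
the unique disjointness matrix: nonzero where `a` and `b` are disjoint, zero where they share
exactly one element. Over a ground set of `m` elements there are `3 ^ m` disjoint pairs, but a
rectangle avoiding the pairs that share exactly one element contains at most `2 ^ m` of them
(Kaibel and Weltge), so at least `(3 / 2) ^ m` facets are needed.
-/

section Facets

open Filter Topology

variable {E : Type*} [NormedAddCommGroup E] [NormedSpace ℝ E]

theorem convex_solutionSet (H : Set ((E →L[ℝ] ℝ) × ℝ)) : Convex ℝ (solutionSet H) := by
  simp only [solutionSet, Set.ofPred_forall]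
  exact convex_iInter₂ fun h _ => convex_halfSpace_le h.1.isLinear h.2

theorem solutionSet_mem_nhds {H : Set ((E →L[ℝ] ℝ) × ℝ)} (hH : H.Finite) {x : E}
    (hx : ∀ h ∈ H, h.1 x < h.2) : solutionSet H ∈ 𝓝 x :=
  (eventually_all_finite hH).2 fun h hh =>
    (h.1.continuous.tendsto x).eventually_le_const (hx h hh)

theorem exists_pos_add_smul_mem_of_mem_nhds {U : Set E} {x : E} (hU : U ∈ 𝓝 x) (v : E) :
    ∃ ε : ℝ, 0 < ε ∧ x + ε • v ∈ U := by
  have hcont : ContinuousAt (fun ε : ℝ => x + ε • v) 0 := by fun_prop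
  have hev : ∀ᶠ ε in 𝓝 (0 : ℝ), x + ε • v ∈ U := hcont (by simpa using hU)
  exact ((eventually_mem_nhdsWithin (s := Set.Ioi 0)).and
    (hev.filter_mono nhdsWithin_le_nhds)).exists

theorem exists_forall_lt_of_convexOn {V ι : Type*} [AddCommGroup V] [Module ℝ V] {C : Set V}
    (hne : C.Nonempty) (s : Finset ι) {f : ι → V → ℝ} {c : ι → ℝ}
    (hf : ∀ i ∈ s, ConvexOn ℝ C (f i)) (hle : ∀ i ∈ s, ∀ x ∈ C, f i x ≤ c i)
    (hlt : ∀ i ∈ s, ∃ x ∈ C, f i x < c i) : ∃ x ∈ C, ∀ i ∈ s, f i x < c i := by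
  classical
  induction s using Finset.induction_on with
  | empty => exact ⟨hne.some, hne.some_mem, by simp⟩
  | insert i s _ ih =>
    simp only [Finset.forall_mem_insert] at hf hle hlt ⊢
    obtain ⟨x, hx, hxs⟩ := ih hf.2 hle.2 hlt.2
    obtain ⟨y, hy, hyi⟩ := hlt.1
    have midpoint_le : ∀ g : V → ℝ, ConvexOn ℝ C g →
        g ((1 / 2 : ℝ) • x + (1 / 2 : ℝ) • y) ≤ 1 / 2 * g x + 1 / 2 * g y := fun g hg =>
      hg.2 hx hy (by norm_num) (by norm_num) (by norm_num)
    refine ⟨(1 / 2 : ℝ) • x + (1 / 2 : ℝ) • y,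
      hf.1.1 hx hy (by norm_num) (by norm_num) (by norm_num), ?_, fun j hj => ?_⟩
    · linarith [midpoint_le _ hf.1, hle.1 x hx]
    · linarith [midpoint_le _ (hf.2 j hj), hxs j hj, hle.2 j hj y hy]

theorem direction_affineSpan_eq_of_forall_exists_add_smul_mem {𝕜 V : Type*} [Field 𝕜]
    [AddCommGroup V] [Module 𝕜 V] {S : Set V} {D : Submodule 𝕜 V} {w : V} (hw : w ∈ S)
    (hS : ∀ x ∈ S, x - w ∈ D) (hD : ∀ v ∈ D, ∃ ε : 𝕜, ε ≠ 0 ∧ w + ε • v ∈ S) :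
    (affineSpan 𝕜 S).direction = D := by
  rw [direction_affineSpan, vectorSpan_eq_span_vsub_set_right 𝕜 hw]
  refine le_antisymm (Submodule.span_le.2 ?_) fun v hv => ?_
  · rintro _ ⟨x, hx, rfl⟩
    exact hS x hx
  · obtain ⟨ε, hε, hmem⟩ := hD v hv
    exact (Submodule.smul_mem_iff _ hε).1 (Submodule.subset_span ⟨_, hmem, by simp⟩)

theorem finrank_inf_ker_add_one {𝕜 V : Type*} [Field 𝕜] [AddCommGroup V] [Module 𝕜 V]
    {D : Submodule 𝕜 V} [FiniteDimensional 𝕜 D] {g : V →ₗ[𝕜] 𝕜} {v : V} (hv : v ∈ D)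
    (hgv : g v ≠ 0) :
    Module.finrank 𝕜 (D ⊓ LinearMap.ker g : Submodule 𝕜 V) + 1 = Module.finrank 𝕜 D := by
  have hne : g.domRestrict D ≠ 0 := fun h0 =>
    hgv (by simpa using LinearMap.congr_fun h0 ⟨v, hv⟩)
  rw [← Module.Dual.finrank_ker_add_one_of_ne_zero hne, LinearMap.ker_domRestrict,
    ← Submodule.finrank_map_subtype_eq, Submodule.map_comap_subtype]

/-- The finite system `s` of linear inequalities cuts `Q` out of the affine hull of `Q`, and no
inequality of `s` can be omitted: each is violated at some point of the affine hull at which all the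
others hold. Working inside the affine hull makes every inequality of such a system define a facet,
even if `Q` is not full-dimensional. -/
structure IsIrredundantDescription (Q : Set E) (s : Finset ((E →L[ℝ] ℝ) × ℝ)) : Prop where
  mem_iff : ∀ x, x ∈ Q ↔ x ∈ affineSpan ℝ Q ∧ x ∈ solutionSet (s : Set ((E →L[ℝ] ℝ) × ℝ))
  exists_violating : ∀ h ∈ s, ∃ z ∈ affineSpan ℝ Q,
    h.2 < h.1 z ∧ ∀ h' ∈ s, h' ≠ h → h'.1 z ≤ h'.2

theorem exists_isIrredundantDescription {H : Set ((E →L[ℝ] ℝ) × ℝ)} (hH : H.Finite) :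
    ∃ s, IsIrredundantDescription (solutionSet H) s := by
  classical
  let Describes (s : Finset ((E →L[ℝ] ℝ) × ℝ)) : Prop := ∀ x, x ∈ solutionSet H ↔
    x ∈ affineSpan ℝ (solutionSet H) ∧ x ∈ solutionSet (s : Set ((E →L[ℝ] ℝ) × ℝ))
  have describes_all : Describes hH.toFinset := fun x => by
    rw [hH.coe_toFinset, iff_and_self]
    exact fun hx => subset_affineSpan ℝ _ hx
  obtain ⟨s, hs⟩ := exists_minimal_of_wellFoundedLT Describes ⟨_, describes_all⟩
  refine ⟨s, hs.prop, fun h hh => ?_⟩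
  by_contra! hcon
  have describes_erase : Describes (s.erase h) := fun x => by
    refine (hs.prop x).trans (and_congr_right fun hx => ⟨fun hxs h' hh' =>
      hxs h' (Finset.mem_of_mem_erase hh'), fun hxs h' hh' => ?_⟩)
    rcases eq_or_ne h' h with rfl | hne
    · by_contra! hlt
      obtain ⟨h'', hmem, hne, hlt'⟩ := hcon x hx hlt
      exact hlt'.not_ge (hxs h'' (Finset.mem_erase.2 ⟨hne, hmem⟩))
    · exact hxs h' (Finset.mem_erase.2 ⟨hne, hh'⟩)
  exact Finset.notMem_erase h s (hs.le_of_le describes_erase (Finset.erase_subset h s) hh)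

namespace IsIrredundantDescription

variable {Q : Set E} {s : Finset ((E →L[ℝ] ℝ) × ℝ)} {h : (E →L[ℝ] ℝ) × ℝ}

theorem le (hs : IsIrredundantDescription Q s) (hh : h ∈ s) {x : E} (hx : x ∈ Q) : h.1 x ≤ h.2 :=
  ((hs.mem_iff x).1 hx).2 h hh

theorem convex (hs : IsIrredundantDescription Q s) : Convex ℝ Q := by
  have hQ : Q = (affineSpan ℝ Q : Set E) ∩ solutionSet (s : Set ((E →L[ℝ] ℝ) × ℝ)) :=
    Set.ext hs.mem_iff
  rw [hQ]
  exact (AffineSubspace.convex _).inter (convex_solutionSet _)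

theorem nonempty (hs : IsIrredundantDescription Q s) (hh : h ∈ s) : Q.Nonempty := by
  obtain ⟨z, hz, -⟩ := hs.exists_violating h hh
  exact (affineSpan_nonempty ℝ).1 ⟨z, hz⟩

theorem exists_lt (hs : IsIrredundantDescription Q s) (hh : h ∈ s) : ∃ x ∈ Q, h.1 x < h.2 := by
  by_contra! hcon
  obtain ⟨z, hz, hzh, -⟩ := hs.exists_violating h hh
  have tight_on_Q : Set.EqOn h.1.toLinearMap.toAffineMap (AffineMap.const ℝ E h.2) Q :=
    fun x hx => le_antisymm (hs.le hh hx) (hcon x hx)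
  exact hzh.ne' (AffineMap.eqOn_affineSpan tight_on_Q hz)

theorem exists_eq_and_forall_lt (hs : IsIrredundantDescription Q s) (hh : h ∈ s) :
    ∃ w ∈ affineSpan ℝ Q, h.1 w = h.2 ∧ ∀ h' ∈ s, h' ≠ h → h'.1 w < h'.2 := by
  obtain ⟨x, hxQ, hx⟩ : ∃ x ∈ Q, ∀ h' ∈ s, h'.1 x < h'.2 :=
    exists_forall_lt_of_convexOn (hs.nonempty hh) s
      (fun h' _ => h'.1.toLinearMap.convexOn hs.convex) (fun _ hh' _ hx => hs.le hh' hx)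
      fun _ hh' => hs.exists_lt hh'
  obtain ⟨z, hzQ, hzh, hz⟩ := hs.exists_violating h hh
  have hxh : h.1 x < h.2 := hx h hh
  obtain ⟨t, ⟨ht0, ht1⟩, ht⟩ : ∃ t ∈ Set.Ioo (0 : ℝ) 1, h.1 x + t * (h.1 z - h.1 x) = h.2 := by
    have hd : 0 < h.1 z - h.1 x := by linarith
    refine ⟨(h.2 - h.1 x) / (h.1 z - h.1 x),
      ⟨div_pos (by linarith) hd, (div_lt_one hd).2 (by linarith)⟩, ?_⟩
    rw [div_mul_cancel₀ _ hd.ne', add_sub_cancel]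
  have apply_lineMap : ∀ g : E →L[ℝ] ℝ,
      g (AffineMap.lineMap x z t) = g x + t * (g z - g x) := fun g => by
    simp only [AffineMap.lineMap_apply_module', map_add, map_smul, map_sub, smul_eq_mul]
    ring
  refine ⟨AffineMap.lineMap x z t, AffineMap.lineMap_mem t (subset_affineSpan ℝ Q hxQ) hzQ,
    by rw [apply_lineMap, ht], fun h' hh' hne => ?_⟩
  rw [apply_lineMap]
  nlinarith [mul_pos (sub_pos.2 ht1) (sub_pos.2 (hx h' hh')),
    mul_nonneg ht0.le (sub_nonneg.2 (hz h' hh' hne))]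

theorem direction_affineSpan_tight (hs : IsIrredundantDescription Q s) (hh : h ∈ s) {w : E}
    (hw : w ∈ affineSpan ℝ Q) (hwh : h.1 w = h.2) (hws : ∀ h' ∈ s, h' ≠ h → h'.1 w < h'.2) :
    (affineSpan ℝ {x ∈ Q | h.1 x = h.2}).direction
      = (affineSpan ℝ Q).direction ⊓ LinearMap.ker (h.1 : E →ₗ[ℝ] ℝ) := by
  classical
  have mem_tight : ∀ x ∈ affineSpan ℝ Q, h.1 x = h.2 →
      x ∈ solutionSet (s.erase h : Set ((E →L[ℝ] ℝ) × ℝ)) → x ∈ {x ∈ Q | h.1 x = h.2} := by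
    refine fun x hx hxh hxs => ⟨(hs.mem_iff x).2 ⟨hx, fun h' hh' => ?_⟩, hxh⟩
    rcases eq_or_ne h' h with rfl | hne
    · exact hxh.le
    · exact hxs h' (Finset.mem_erase.2 ⟨hne, hh'⟩)
  have near_w : solutionSet (s.erase h : Set ((E →L[ℝ] ℝ) × ℝ)) ∈ 𝓝 w :=
    solutionSet_mem_nhds (Finset.finite_toSet _) fun h' hh' =>
      hws h' (Finset.mem_of_mem_erase hh') (Finset.ne_of_mem_erase hh')
  refine direction_affineSpan_eq_of_forall_exists_add_smul_mem
    (mem_tight w hw hwh (mem_of_mem_nhds near_w)) (fun x hx => ⟨?_, ?_⟩) fun v hv => ?_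
  · exact AffineSubspace.vsub_mem_direction (subset_affineSpan ℝ Q hx.1) hw
  · simp [hx.2, hwh]
  · obtain ⟨hvQ, hvh : h.1 v = 0⟩ := hv
    obtain ⟨ε, hε, hmem⟩ := exists_pos_add_smul_mem_of_mem_nhds near_w v
    refine ⟨ε, hε.ne', mem_tight _ ?_ (by simp [hvh, hwh]) hmem⟩
    rw [add_comm]
    exact AffineSubspace.vadd_mem_of_mem_direction (Submodule.smul_mem _ ε hvQ) hw

theorem isFacet [FiniteDimensional ℝ E] (hs : IsIrredundantDescription Q s) (hh : h ∈ s) :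
    IsFacet Q {x ∈ Q | h.1 x = h.2} := by
  obtain ⟨w, hw, hwh, hws⟩ := hs.exists_eq_and_forall_lt hh
  obtain ⟨z, hz, hzh, -⟩ := hs.exists_violating h hh
  have hwQ : w ∈ Q := (hs.mem_iff w).2 ⟨hw, fun h' hh' => by
    rcases eq_or_ne h' h with rfl | hne
    exacts [hwh.le, (hws h' hh' hne).le]⟩
  refine ⟨fun _ => ⟨h.1, ?_⟩, ⟨w, hwQ, hwh⟩, ?_⟩
  · ext x
    refine and_congr_right fun hx => ⟨fun hxh y hy => hxh ▸ hs.le hh hy, fun hmax => ?_⟩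
    exact (hs.le hh hx).antisymm (hwh ▸ hmax w hwQ)
  · have hzw : h.1 (z - w) ≠ 0 := by
      rw [map_sub, hwh]
      exact (sub_pos.2 hzh).ne'
    rw [affineDim, affineDim, hs.direction_affineSpan_tight hh hw hwh hws]
    exact finrank_inf_ker_add_one (AffineSubspace.vsub_mem_direction hz hw) hzw

theorem exists_tight_on_face_and_lt (hs : IsIrredundantDescription Q s) {f : E →ₗ[ℝ] ℝ} {c : ℝ}
    (hf : ∀ x ∈ Q, f x ≤ c) (hne : ∃ x ∈ Q, f x = c) {q : E} (hq : q ∈ Q) (hfq : f q < c) :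
    ∃ h ∈ s, (∀ x ∈ Q, f x = c → h.1 x = h.2) ∧ h.1 q < h.2 := by
  classical
  by_contra! hcon
  have hG : Convex ℝ {x ∈ Q | f x = c} :=
    hs.convex.inter ((convex_singleton c).linear_preimage f)
  let s' := {h ∈ s | ∃ x ∈ {x ∈ Q | f x = c}, h.1 x < h.2}
  obtain ⟨g, ⟨hgQ, hgc⟩, hgs⟩ := exists_forall_lt_of_convexOn hne s'
    (fun h _ => h.1.toLinearMap.convexOn hG)
    (fun h hh x hx => hs.le (Finset.mem_filter.1 hh).1 hx.1)
    fun h hh => (Finset.mem_filter.1 hh).2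
  -- Every inequality tight at `g` is tight at `q`, so one can move past `g` on the ray from `q`.
  obtain ⟨ε, hε, hmem⟩ := exists_pos_add_smul_mem_of_mem_nhds
    (solutionSet_mem_nhds s'.finite_toSet hgs) (g - q)
  have hmemQ : g + ε • (g - q) ∈ Q := by
    refine (hs.mem_iff _).2 ⟨?_, fun h hh => ?_⟩
    · rw [add_comm]
      exact AffineSubspace.vadd_mem_of_mem_direction (Submodule.smul_mem _ ε
        (AffineSubspace.vsub_mem_direction (subset_affineSpan ℝ Q hgQ)
          (subset_affineSpan ℝ Q hq))) (subset_affineSpan ℝ Q hgQ)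
    · by_cases hslack : ∃ x ∈ {x ∈ Q | f x = c}, h.1 x < h.2
      · exact hmem h (Finset.mem_filter.2 ⟨hh, hslack⟩)
      · push Not at hslack
        have tight : ∀ x ∈ Q, f x = c → h.1 x = h.2 := fun x hx hfx =>
          (hs.le hh hx).antisymm (hslack x ⟨hx, hfx⟩)
        have tight_q : h.1 q = h.2 := (hs.le hh hq).antisymm (hcon h hh tight)
        simp [tight g hgQ hgc, tight_q]
  have hbound := hf _ hmemQ
  simp only [map_add, map_smul, map_sub, smul_eq_mul, hgc] at hbound
  nlinarith [mul_pos hε (sub_pos.2 hfq)]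

end IsIrredundantDescription

theorem exists_isFacet_superset_face_notMem [FiniteDimensional ℝ E]
    {H : Set ((E →L[ℝ] ℝ) × ℝ)} (hH : H.Finite) {f : E →ₗ[ℝ] ℝ} {c : ℝ}
    (hf : ∀ x ∈ solutionSet H, f x ≤ c) (hne : ∃ x ∈ solutionSet H, f x = c) {q : E}
    (hq : q ∈ solutionSet H) (hfq : f q < c) :
    ∃ F, IsFacet (solutionSet H) F ∧ {x ∈ solutionSet H | f x = c} ⊆ F ∧ q ∉ F := by
  obtain ⟨s, hs⟩ := exists_isIrredundantDescription hH
  obtain ⟨h, hh, tight_on_face, hhq⟩ := hs.exists_tight_on_face_and_lt hf hne hq hfq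
  exact ⟨_, hs.isFacet hh, fun x hx => ⟨hx.1, tight_on_face x hx.1 hx.2⟩, fun hqF => hhq.ne hqF.2⟩

end Facets

section Rectangles

open Finset

variable {α : Type*} [DecidableEq α]

/-- The pairs of disjoint sets in the combinatorial rectangle `𝒜 × ℬ`. -/
def disjointPairs (𝒜 ℬ : Finset (Finset α)) : Finset (Finset α × Finset α) :=
  {p ∈ 𝒜 ×ˢ ℬ | Disjoint p.1 p.2}

theorem mem_disjointPairs {𝒜 ℬ : Finset (Finset α)} {p : Finset α × Finset α} :
    p ∈ disjointPairs 𝒜 ℬ ↔ p.1 ∈ 𝒜 ∧ p.2 ∈ ℬ ∧ Disjoint p.1 p.2 := by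
  rw [disjointPairs, mem_filter, mem_product, and_assoc]

theorem card_disjointPairs_powerset (s : Finset α) :
    #(disjointPairs s.powerset s.powerset) = 3 ^ #s := by
  have card_disjoint : ∀ a ∈ s.powerset, #{b ∈ s.powerset | Disjoint a b} = 2 ^ (#s - #a) := by
    intro a ha
    have hsdiff : {b ∈ s.powerset | Disjoint a b} = (s \ a).powerset := by
      ext b
      simp only [mem_filter, mem_powerset, subset_sdiff, disjoint_comm]
    rw [hsdiff, card_powerset, card_sdiff_of_subset (mem_powerset.1 ha)]
  calc #(disjointPairs s.powerset s.powerset)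
      = ∑ a ∈ s.powerset, #{b ∈ s.powerset | Disjoint a b} := by
        simp only [disjointPairs, card_filter, sum_product]
    _ = ∑ a ∈ s.powerset, 1 ^ #a * 2 ^ (#s - #a) := by
        simpa using sum_congr rfl card_disjoint
    _ = 3 ^ #s := sum_pow_mul_eq_add_pow 1 2 s

theorem eq_of_erase_eq_erase {x : α} {c c' : Finset α} (h : c.erase x = c'.erase x)
    (hc : x ∉ c → c' ≠ insert x c) (hc' : x ∉ c' → c ≠ insert x c') : c = c' := by
  by_cases hx : x ∈ c <;> by_cases hx' : x ∈ c'
  · rw [← insert_erase hx, h, insert_erase hx']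
  · exact absurd (by rw [← erase_eq_of_notMem hx', ← h, insert_erase hx]) (hc' hx')
  · exact absurd (by rw [← erase_eq_of_notMem hx, h, insert_erase hx']) (hc hx)
  · rw [← erase_eq_of_notMem hx, h, erase_eq_of_notMem hx']

theorem card_disjointPairs_le_add {𝒜 ℬ : Finset (Finset α)}
    (hinter : ∀ a ∈ 𝒜, ∀ b ∈ ℬ, #(a ∩ b) ≠ 1) (x : α) :
    #(disjointPairs 𝒜 ℬ) ≤
      #(disjointPairs (𝒜.nonMemberSubfamily x) (ℬ.image (erase · x))) +
        #(disjointPairs (𝒜.image (erase · x)) (ℬ.nonMemberSubfamily x)) := by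
  have insert_notMem : ∀ {a b}, Disjoint a b → insert x a ∈ 𝒜 → insert x b ∉ ℬ := by
    intro a b hab ha hb
    refine hinter _ ha _ hb ?_
    rw [← insert_inter_distrib, disjoint_iff_inter_eq_empty.1 hab, insert_empty, card_singleton]
  -- A pair in which both sets omit `x` is sent to the half where it cannot collide with its twin:
  -- `(a, insert x b)` in the first half, `(insert x a, b)` in the second.
  rw [← card_filter_add_card_filter_not (s := disjointPairs 𝒜 ℬ)
    fun p => x ∈ p.2 ∨ x ∉ p.1 ∧ insert x p.2 ∉ ℬ]
  refine add_le_add (card_le_card_of_injOn (fun p => (p.1, p.2.erase x)) ?_ ?_)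
    (card_le_card_of_injOn (fun p => (p.1.erase x, p.2)) ?_ ?_)
  all_goals simp only [Set.MapsTo, Set.InjOn, mem_coe, mem_filter, mem_disjointPairs,
    mem_nonMemberSubfamily, Prod.forall, Prod.mk.injEq, not_or, not_and_or, not_not]
  · rintro a b ⟨⟨ha, hb, hab⟩, hside⟩
    have hxa : x ∉ a := hside.elim (fun hxb => disjoint_right.1 hab hxb) And.left
    exact ⟨⟨ha, hxa⟩, mem_image_of_mem _ hb, hab.mono_right (erase_subset x b)⟩
  · rintro a b ⟨⟨-, hb, -⟩, hside⟩ a' b' ⟨⟨-, hb', -⟩, hside'⟩ ⟨rfl, herase⟩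
    refine ⟨rfl, eq_of_erase_eq_erase herase ?_ ?_⟩
    · rintro hxb rfl
      exact (hside.resolve_left hxb).2 hb'
    · rintro hxb' rfl
      exact (hside'.resolve_left hxb').2 hb
  · rintro a b ⟨⟨ha, hb, hab⟩, hxb, -⟩
    exact ⟨mem_image_of_mem _ ha, ⟨hb, hxb⟩, hab.mono_left (erase_subset x a)⟩
  · rintro a b ⟨⟨ha, -, hab⟩, -, hside⟩ a' b' ⟨⟨ha', -, hab'⟩, -, hside'⟩ ⟨herase, rfl⟩
    refine ⟨eq_of_erase_eq_erase herase ?_ ?_, rfl⟩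
    · rintro hxa rfl
      exact insert_notMem hab ha' (hside.resolve_left hxa)
    · rintro hxa' rfl
      exact insert_notMem hab' ha (hside'.resolve_left hxa')

theorem card_disjointPairs_le_two_pow {s : Finset α} {𝒜 ℬ : Finset (Finset α)}
    (h𝒜 : 𝒜 ⊆ s.powerset) (hℬ : ℬ ⊆ s.powerset) (hinter : ∀ a ∈ 𝒜, ∀ b ∈ ℬ, #(a ∩ b) ≠ 1) :
    #(disjointPairs 𝒜 ℬ) ≤ 2 ^ #s := by
  induction s using Finset.induction_on generalizing 𝒜 ℬ with
  | empty =>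
    calc #(disjointPairs 𝒜 ℬ) ≤ #(𝒜 ×ˢ ℬ) := card_filter_le _ _
      _ ≤ #((∅ : Finset α).powerset ×ˢ (∅ : Finset α).powerset) :=
        card_le_card (product_subset_product h𝒜 hℬ)
      _ = 2 ^ #(∅ : Finset α) := rfl
  | insert x s hx ih =>
    have nonMember_subset : ∀ 𝒞 ⊆ (insert x s).powerset, 𝒞.nonMemberSubfamily x ⊆ s.powerset := by
      intro 𝒞 h𝒞 c hc
      obtain ⟨hc𝒞, hxc⟩ := mem_nonMemberSubfamily.1 hc
      exact mem_powerset.2 ((subset_insert_iff_of_notMem hxc).1 (mem_powerset.1 (h𝒞 hc𝒞)))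
    have erase_subset : ∀ 𝒞 ⊆ (insert x s).powerset, 𝒞.image (erase · x) ⊆ s.powerset := by
      intro 𝒞 h𝒞
      exact image_subset_iff.2 fun c hc =>
        mem_powerset.2 (subset_insert_iff.1 (mem_powerset.1 (h𝒞 hc)))
    calc #(disjointPairs 𝒜 ℬ) ≤ _ := card_disjointPairs_le_add hinter x
      _ ≤ 2 ^ #s + 2 ^ #s := add_le_add
        (ih (nonMember_subset 𝒜 h𝒜) (erase_subset ℬ hℬ) ?_)
        (ih (erase_subset 𝒜 h𝒜) (nonMember_subset ℬ hℬ) ?_)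
      _ = 2 ^ #(insert x s) := by rw [card_insert_of_notMem hx, pow_succ, mul_two]
    · simp only [mem_nonMemberSubfamily, forall_mem_image]
      rintro a ⟨ha, hxa⟩ b hb
      rw [← erase_inter_comm, erase_eq_of_notMem hxa]
      exact hinter a ha b hb
    · simp only [mem_nonMemberSubfamily, forall_mem_image]
      rintro a ha b ⟨hb, hxb⟩
      rw [erase_inter_comm, erase_eq_of_notMem hxb]
      exact hinter a ha b hb

theorem three_pow_le_card_mul_two_pow {ι : Type*} [Fintype ι] {s : Finset α}
    {𝒜 ℬ : ι → Finset (Finset α)} (h𝒜 : ∀ i, 𝒜 i ⊆ s.powerset) (hℬ : ∀ i, ℬ i ⊆ s.powerset)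
    (hinter : ∀ i, ∀ a ∈ 𝒜 i, ∀ b ∈ ℬ i, #(a ∩ b) ≠ 1)
    (hcover : ∀ a ⊆ s, ∀ b ⊆ s, Disjoint a b → ∃ i, a ∈ 𝒜 i ∧ b ∈ ℬ i) :
    3 ^ #s ≤ Fintype.card ι * 2 ^ #s := by
  classical
  have covered : disjointPairs s.powerset s.powerset ⊆
      univ.biUnion fun i => disjointPairs (𝒜 i) (ℬ i) := by
    intro p hp
    obtain ⟨ha, hb, hab⟩ := mem_disjointPairs.1 hp
    obtain ⟨i, hai, hbi⟩ := hcover p.1 (mem_powerset.1 ha) p.2 (mem_powerset.1 hb) hab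
    exact mem_biUnion.2 ⟨i, mem_univ i, mem_disjointPairs.2 ⟨hai, hbi, hab⟩⟩
  calc 3 ^ #s = #(disjointPairs s.powerset s.powerset) := (card_disjointPairs_powerset s).symm
    _ ≤ #(univ.biUnion fun i => disjointPairs (𝒜 i) (ℬ i)) := card_le_card covered
    _ ≤ Fintype.card ι * 2 ^ #s := card_biUnion_le_card_mul _ _ _ fun i _ =>
        card_disjointPairs_le_two_pow (h𝒜 i) (hℬ i) (hinter i)

end Rectangles

section ExtensionComplexity

open Finset

variable {α E : Type*} [DecidableEq α] [NormedAddCommGroup E] [NormedSpace ℝ E]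

/-- The inequalities `f a x ≤ c a`, valid and tight somewhere on `P`, and the points `q b` of `P`,
with `a` and `b` ranging over the subsets of `s`, form a unique disjointness pattern: the slack
`c a - f a (q b)` is positive if `a` and `b` are disjoint and zero if they share exactly one
element. All other entries of the slack matrix are left unspecified. -/
structure IsUniqueDisjointnessPattern (P : Set E) (s : Finset α) (f : Finset α → E →ₗ[ℝ] ℝ)
    (c : Finset α → ℝ) (q : Finset α → E) : Prop where
  le : ∀ a ⊆ s, ∀ x ∈ P, f a x ≤ c a
  exists_eq : ∀ a ⊆ s, ∃ x ∈ P, f a x = c a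
  mem : ∀ b ⊆ s, q b ∈ P
  lt : ∀ a ⊆ s, ∀ b ⊆ s, Disjoint a b → f a (q b) < c a
  eq : ∀ a ⊆ s, ∀ b ⊆ s, #(a ∩ b) = 1 → f a (q b) = c a

namespace IsUniqueDisjointnessPattern

variable {P : Set E} {s : Finset α} {f : Finset α → E →ₗ[ℝ] ℝ} {c : Finset α → ℝ}
  {q : Finset α → E}

theorem three_pow_le_polytopeSize_mul [FiniteDimensional ℝ E] {H : Set ((E →L[ℝ] ℝ) × ℝ)}
    (hH : H.Finite) (hs : IsUniqueDisjointnessPattern (solutionSet H) s f c q) :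
    (3 : ℕ∞) ^ #s ≤ polytopeSize (solutionSet H) * 2 ^ #s := by
  classical
  rcases Set.finite_or_infinite {F | IsFacet (solutionSet H) F} with hfin | hinf
  · let := hfin.fintype
    have hcount := three_pow_le_card_mul_two_pow (ι := {F | IsFacet (solutionSet H) F}) (s := s)
      (𝒜 := fun F => {a ∈ s.powerset | {x ∈ solutionSet H | f a x = c a} ⊆ F.1})
      (ℬ := fun F => {b ∈ s.powerset | q b ∉ F.1})
      (fun _ => filter_subset _ _) (fun _ => filter_subset _ _) ?_ ?_
    · rw [polytopeSize, Set.encard_eq_coe_toFinset_card, Set.toFinset_card]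
      exact_mod_cast hcount
    · intro F a ha b hb hab
      simp only [mem_filter, mem_powerset] at ha hb
      exact hb.2 (ha.2 ⟨hs.mem b hb.1, hs.eq a ha.1 b hb.1 hab⟩)
    · intro a ha b hb hab
      obtain ⟨F, hF, face_subset, hbF⟩ := exists_isFacet_superset_face_notMem hH (hs.le a ha)
        (hs.exists_eq a ha) (hs.mem b hb) (hs.lt a ha b hb hab)
      exact ⟨⟨F, hF⟩, mem_filter.2 ⟨mem_powerset.2 ha, face_subset⟩,
        mem_filter.2 ⟨mem_powerset.2 hb, hbF⟩⟩
  · rw [polytopeSize, hinf.encard_eq, ENat.top_mul (by positivity)]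
    exact le_top

theorem exists_extension {r : ℕ} {Q : Set (E × (Fin r → ℝ))}
    (hs : IsUniqueDisjointnessPattern P s f c q) (hQ : IsExtension P Q) :
    ∃ q', IsUniqueDisjointnessPattern Q s
      (fun a => f a ∘ₗ LinearMap.fst ℝ E (Fin r → ℝ)) c q' := by
  obtain ⟨-, rfl⟩ := hQ
  choose! y hy using hs.mem
  refine ⟨fun b => (q b, y b), fun a ha x hx => hs.le a ha x.1 ⟨x.2, hx⟩, fun a ha => ?_, hy,
    hs.lt, hs.eq⟩
  obtain ⟨x, ⟨z, hxz⟩, hfx⟩ := hs.exists_eq a ha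
  exact ⟨(x, z), hxz, hfx⟩

theorem three_pow_le_extensionComplexity_mul [FiniteDimensional ℝ E]
    (hs : IsUniqueDisjointnessPattern P s f c q) :
    (3 : ℕ∞) ^ #s ≤ extensionComplexity P * 2 ^ #s := by
  have two_pow_ne_zero : (2 : ℕ∞) ^ #s ≠ 0 := by positivity
  simp only [extensionComplexity, ENat.iInf_mul_of_ne two_pow_ne_zero]
  refine le_iInf fun r => le_iInf fun Q => le_iInf fun hQ => ?_
  obtain ⟨q', hq'⟩ := hs.exists_extension hQ
  obtain ⟨⟨-, H, hH, rfl⟩, -⟩ := hQ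
  exact hq'.three_pow_le_polytopeSize_mul hH

end IsUniqueDisjointnessPattern

end ExtensionComplexity

section QAP

open Finset

/-- The linear form for which the QAP5 inequality with parameters `β` and `ν i j` reads
`qap5Form β ν Y ≤ β * (β - 1)`. -/
def qap5Form {n : ℕ} (β : ℤ) (ν : Fin n → Fin n → ℤ) : QAPSpace n →ₗ[ℝ] ℝ where
  toFun Y := (2 * (β : ℝ) - 1) * (∑ i, ∑ j, (ν i j : ℝ) * Y (i, j) (i, j))
    - ∑ i, ∑ j, ∑ k, ∑ l, (ν i j : ℝ) * (ν k l : ℝ) * Y (i, j) (k, l)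
  map_add' Y Z := by
    simp only [Pi.add_apply, mul_add, sum_add_distrib]
    ring
  map_smul' t Y := by
    simp only [Pi.smul_apply, smul_eq_mul, RingHom.id_apply, mul_left_comm _ t, ← mul_sum, mul_sub]

theorem qap5Form_apply {n : ℕ} (β : ℤ) (ν : Fin n → Fin n → ℤ) (Y : QAPSpace n) :
    qap5Form β ν Y = (2 * (β : ℝ) - 1) * (∑ i, ∑ j, (ν i j : ℝ) * Y (i, j) (i, j))
      - ∑ i, ∑ j, ∑ k, ∑ l, (ν i j : ℝ) * (ν k l : ℝ) * Y (i, j) (k, l) :=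
  rfl

theorem satisfiesQAP5_iff {n : ℕ} {β : ℤ} {ν : Fin n → Fin n → ℤ} {Y : QAPSpace n} :
    SatisfiesQAP5 β ν Y ↔ qap5Form β ν Y ≤ β * (β - 1) := by
  rw [SatisfiesQAP5, qap5Form_apply]
  constructor <;> intro h <;> linarith

theorem qap5Form_qapVertex {n : ℕ} (β : ℤ) (ν : Fin n → Fin n → ℤ) (σ : Equiv.Perm (Fin n)) :
    qap5Form β ν (qapVertex σ) =
      (2 * β - 1) * (∑ i, (ν i (σ i) : ℝ)) - (∑ i, (ν i (σ i) : ℝ)) ^ 2 := by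
  rw [qap5Form_apply, sq, sum_mul_sum]
  simp [qapVertex]

/-- The coefficients `ν` of the QAP5 inequality that counts the fixed points lying in `a`: the
indicator of the set of diagonal positions `(i, i)` with `i ∈ a`. -/
def diagonalIndicator {n : ℕ} (a : Finset (Fin n)) (i j : Fin n) : ℤ :=
  if i ∈ a ∧ i = j then 1 else 0

theorem sum_diagonalIndicator {n : ℕ} (a : Finset (Fin n)) (σ : Equiv.Perm (Fin n)) :
    ∑ i, (diagonalIndicator a i (σ i) : ℝ) = #(a \ σ.support) := by
  have fixed_mem_iff : ∀ i, i ∈ a ∧ i = σ i ↔ i ∈ a \ σ.support := fun i => by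
    rw [mem_sdiff, Equiv.Perm.notMem_support, eq_comm]
  simp only [diagonalIndicator, fixed_mem_iff, Int.cast_ite, Int.cast_one, Int.cast_zero,
    sum_boole, filter_univ_mem]

theorem exists_perm_support_eq {α : Type*} [DecidableEq α] [Fintype α] {s : Finset α}
    (hs : s.Nontrivial) : ∃ σ : Equiv.Perm α, σ.support = s := by
  obtain ⟨σ, hσ, hsupport⟩ := s.exists_cycleOn
  exact ⟨σ, hsupport.antisymm fun _ hx => Equiv.Perm.mem_support.2 (hσ.apply_ne hs hx)⟩

theorem exists_perm_forall_qap5Form_eq {n : ℕ} {b : Finset (Fin n)} (hb : bᶜ.Nontrivial) :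
    ∃ σ : Equiv.Perm (Fin n), ∀ a, qap5Form 2 (diagonalIndicator a) (qapVertex σ) =
      3 * (#(a ∩ b) : ℝ) - (#(a ∩ b) : ℝ) ^ 2 := by
  obtain ⟨σ, hσ⟩ := exists_perm_support_eq hb
  refine ⟨σ, fun a => ?_⟩
  rw [qap5Form_qapVertex, sum_diagonalIndicator, hσ, sdiff_compl, inf_eq_inter]
  norm_num

theorem exists_isUniqueDisjointnessPattern {n : ℕ} (hn : 3 ≤ n) {R : Set (QAPSpace n)}
    (hR : qapPolytope n ⊆ R)
    (hvalid : ∀ (a : Finset (Fin n)), ∀ Y ∈ R, SatisfiesQAP5 2 (diagonalIndicator a) Y) :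
    ∃ s : Finset (Fin n), #s = n - 2 ∧ ∃ f c q, IsUniqueDisjointnessPattern R s f c q := by
  obtain ⟨x, y, hxy⟩ : ∃ x y : Fin n, x ≠ y := ⟨⟨0, by lia⟩, ⟨1, by lia⟩, by simp⟩
  have vertex_mem : ∀ σ : Equiv.Perm (Fin n), qapVertex σ ∈ R := fun σ =>
    hR (subset_convexHull ℝ _ ⟨σ, rfl⟩)
  have compl_nontrivial : ∀ b ⊆ ({x, y}ᶜ : Finset (Fin n)), bᶜ.Nontrivial := fun b hb =>
    ⟨x, le_compl_comm.1 hb (by simp), y, le_compl_comm.1 hb (by simp), hxy⟩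
  have inter_eq : ∀ a, ∀ b ⊆ ({x, y}ᶜ : Finset (Fin n)), insert x a ∩ b = a ∩ b :=
    fun a b hb => insert_inter_of_notMem fun h => by simpa using hb h
  choose! σ hσ using fun b hb => exists_perm_forall_qap5Form_eq (compl_nontrivial b hb)
  -- The extra element `x` lets the vertex of a permutation fixing only `x` be tight for every `a`.
  refine ⟨{x, y}ᶜ, by rw [card_compl, Fintype.card_fin, card_pair hxy],
    fun a => qap5Form 2 (diagonalIndicator (insert x a)), fun _ => 2, fun b => qapVertex (σ b),
    fun a _ Y hY => ?_, fun a _ => ?_, fun b _ => vertex_mem (σ b), fun a _ b hb hab => ?_,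
    fun a _ b hb hab => ?_⟩
  · have hle := satisfiesQAP5_iff.1 (hvalid (insert x a) Y hY)
    norm_num at hle
    exact hle
  · have hx : ({x}ᶜ : Finset (Fin n)).Nontrivial := by
      rw [← one_lt_card_iff_nontrivial, card_compl, Fintype.card_fin, card_singleton]
      lia
    obtain ⟨τ, hτ⟩ := exists_perm_forall_qap5Form_eq hx
    refine ⟨qapVertex τ, vertex_mem τ, ?_⟩
    rw [hτ, inter_singleton_of_mem (mem_insert_self x a), card_singleton]
    norm_num
  · rw [hσ b hb, inter_eq a b hb, disjoint_iff_inter_eq_empty.1 hab, card_empty]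
    norm_num
  · rw [hσ b hb, inter_eq a b hb, hab]
    norm_num

end QAP

theorem two_rpow_quarter_mul_le_three_halves_pow {n : ℕ} (hn : 4 ≤ n) :
    (2 : ℝ) ^ ((1 / 4 : ℝ) * n) ≤ (3 / 2) ^ (n - 2) := by
  have quarter_le_half : (1 / 4 : ℝ) * n ≤ 1 / 2 * (n - 2 : ℕ) := by
    have hn' : (4 : ℝ) ≤ n := by exact_mod_cast hn
    rw [Nat.cast_sub (by lia)]
    linarith
  calc (2 : ℝ) ^ ((1 / 4 : ℝ) * n) ≤ 2 ^ ((1 / 2 : ℝ) * (n - 2 : ℕ)) :=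
        Real.rpow_le_rpow_of_exponent_le one_le_two quarter_le_half
    _ = √2 ^ (n - 2) := by rw [Real.rpow_mul_natCast zero_le_two, Real.sqrt_eq_rpow]
    _ ≤ (3 / 2) ^ (n - 2) :=
        pow_le_pow_left₀ (Real.sqrt_nonneg 2) (Real.sqrt_le_iff.2 (by norm_num)) _

theorem two_rpow_quarter_mul_le_of_three_pow_le {n : ℕ} (hn : 4 ≤ n) {N : ℕ∞}
    (hN : (3 : ℕ∞) ^ (n - 2) ≤ N * 2 ^ (n - 2)) :
    (2 : ℝ≥0∞) ^ ((1 / 4 : ℝ) * n) ≤ N := by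
  cases N with
  | top => exact le_top
  | coe N =>
    have three_halves_pow_le : (3 / 2 : ℝ) ^ (n - 2) ≤ N := by
      rw [div_pow, div_le_iff₀ (by positivity)]
      exact_mod_cast hN
    calc (2 : ℝ≥0∞) ^ ((1 / 4 : ℝ) * n) = ENNReal.ofReal (2 ^ ((1 / 4 : ℝ) * n)) := by
          rw [← ENNReal.ofReal_rpow_of_pos two_pos, ENNReal.ofReal_ofNat]
      _ ≤ ENNReal.ofReal N := ENNReal.ofReal_le_ofReal
          ((two_rpow_quarter_mul_le_three_halves_pow hn).trans three_halves_pow_le)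
      _ = (N : ℕ∞) := by rw [ENNReal.ofReal_natCast, ENat.toENNReal_coe]

theorem mainTheorem6_general {n : ℕ} (hn : 3 ≤ n) {R : Set (QAPSpace n)}
    (hR : qapPolytope n ⊆ R)
    (hvalid : ∀ a : Finset (Fin n), ∀ Y ∈ R, SatisfiesQAP5 2 (diagonalIndicator a) Y) :
    (3 : ℕ∞) ^ (n - 2) ≤ extensionComplexity R * 2 ^ (n - 2) := by
  obtain ⟨s, hs, f, c, q, hpattern⟩ := exists_isUniqueDisjointnessPattern hn hR hvalid
  exact hs ▸ hpattern.three_pow_le_extensionComplexity_mul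

theorem mainTheorem6 :
    ∃ c : ℝ, 0 < c ∧ ∃ N : ℕ, ∀ n : ℕ, N ≤ n →
      ∀ R : Set (QAPSpace n),
        IsRelaxation (qapPolytope n) R →
        Bornology.IsBounded R →
        (∀ (β : ℤ) (ν : Fin n → Fin n → ℤ), ∀ Y ∈ R, SatisfiesQAP5 β ν Y) →
        (2 : ℝ≥0∞) ^ (c * (n : ℝ)) ≤ ((extensionComplexity R : ℕ∞) : ℝ≥0∞) :=
  ⟨1 / 4, by norm_num, 4, fun _ hn _ hR _ hvalid =>
    two_rpow_quarter_mul_le_of_three_pow_le hn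
      (mainTheorem6_general (by lia) hR.2 fun a => hvalid 2 (diagonalIndicator a))⟩
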